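/- Let $\operatorname{Av}(4213,3142)$ be the class of permutations that contain neither $4213$ nor $3142$ as a pattern, that is, those with no subsequence order isomorphic to $4213$ or to $3142$. For $n\ge 1$ let $f_n$ be the number of permutations of length $n$ in this class, and let $f=\sum_{n\ge 1} f_n x^n$ be the generating function of its nonempty members. Then, as formal power series in $x$, \[ \begin{aligned} &x^3f^6+(7x^3-7x^2+2x)f^5+(x^4+14x^3-21x^2+10x-1)f^4\\ &\quad+(4x^4+8x^3-19x^2+11x-2)f^3+(6x^4-5x^3-2x^2+2x)f^2\\ &\quad+(4x^4-7x^3+4x^2-x)f+x^4-2x^3+x^2=0. \end{aligned} \] -/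

import Mathlib

/-- A permutation of length `n`, in one-line notation `π(1) π(2) … π(n)`, is an element of
`Equiv.Perm (Fin n)` (positions and values are both shifted down by one). The permutation `π` contains
the pattern `σ` if some subsequence of `π` (given by a strictly increasing choice of
positions) is order isomorphic to `σ`. -/
def PermContains {k n : ℕ} (σ : Equiv.Perm (Fin k)) (π : Equiv.Perm (Fin n)) : Prop :=
  ∃ g : Fin k → Fin n, StrictMono g ∧ ∀ i j : Fin k, σ i < σ j ↔ π (g i) < π (g j)

/-- The permutation with one-line notation `4213`. -/
def perm4213 : Equiv.Perm (Fin 4) where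
  toFun := ![3, 1, 0, 2]
  invFun := ![2, 1, 3, 0]
  left_inv := by decide
  right_inv := by decide

/-- The permutation with one-line notation `3142`. -/
def perm3142 : Equiv.Perm (Fin 4) where
  toFun := ![2, 0, 3, 1]
  invFun := ![1, 3, 0, 2]
  left_inv := by decide
  right_inv := by decide

/-- The permutations of length `n` in the class `Av(σ, τ)`. -/
def avPair {k l : ℕ} (σ : Equiv.Perm (Fin k)) (τ : Equiv.Perm (Fin l)) (n : ℕ) :
    Set (Equiv.Perm (Fin n)) :=
  {π | ¬ PermContains σ π ∧ ¬ PermContains τ π}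

/-- The generating function, counted by length, of the nonempty permutations in `Av(σ, τ)`,
as a formal power series: the coefficient of `x ^ n` is the number of permutations of length `n`
in the class if `1 ≤ n`, and the constant term is `0`. -/
noncomputable def avPairGenFun {k l : ℕ} (σ : Equiv.Perm (Fin k)) (τ : Equiv.Perm (Fin l)) :
    PowerSeries ℤ :=
  PowerSeries.mk fun n => if n = 0 then 0 else ((avPair σ τ n).ncard : ℤ)

/-! Split a nonempty permutation at its least entry as α 0 β. It avoids 4213 and 3142 exactly when α
and β do, no inversion of α straddles a value of β (else 4213, with 0 as the 1), no inversion of β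
straddles a value of α (else 3142), and β avoids 213 below the maximum of α
(`avoidsBoth_surroundZero`).

In such a merge the entries of β above max α come after its other entries, so they form a free block
on top. Cutting it off (`sizeGenFun_glue`) leaves a merge whose greatest entry lies in the first
list. Top blocks can then be cut off from the two lists alternately (`sizeGenFun_mergesTopFst`). A
list avoiding 4213 and 3142 splits into two such lists, a 213-avoider below a nonempty block has to
be increasing, and an increasing list splits into two increasing ones, so only four merge series q,
r, z, t occur. With d and y the series of nonempty 213-avoiders and nonempty increasing
permutations,

f = x q (1 + f), q = 1 + r f, r = 1 + z d, z = 1 + t f, t = 1 + z y, d = x (1 + d)^2, (1 + y)(1 - x)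
= 1.

Eliminating all unknowns but x and f gives the equation (`polynomial_eq_zero_of_system`). -/

/-! ### Generating functions of sets with a size function. -/

/-- The generating function of the set `A`, counted by the size function `s`. -/
noncomputable def sizeGenFun {T : Type*} (s : T → ℕ) (A : Set T) : PowerSeries ℤ :=
  PowerSeries.mk fun n => ({t | t ∈ A ∧ s t = n}.ncard : ℤ)

/-- The size function `s` takes each value finitely often on `A`. -/
def FiniteFibers {T : Type*} (s : T → ℕ) (A : Set T) : Prop :=
  ∀ n, {t | t ∈ A ∧ s t = n}.Finite

section GenFun

variable {T T' : Type*} {s : T → ℕ} {s' : T' → ℕ}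

theorem FiniteFibers.mono {A B : Set T} (h : FiniteFibers s B) (hAB : A ⊆ B) :
    FiniteFibers s A :=
  fun n => (h n).subset fun _ ht => ⟨hAB ht.1, ht.2⟩

theorem bijOn_fiber {A : Set T} {B : Set T'} {φ : T → T'} (h : Set.BijOn φ A B) {k : ℕ}
    (hs : ∀ t ∈ A, s' (φ t) = s t + k) (n : ℕ) :
    Set.BijOn φ {t | t ∈ A ∧ s t = n} {t | t ∈ B ∧ s' t = n + k} := by
  refine ⟨fun t ht => ⟨h.mapsTo ht.1, by rw [hs t ht.1, ht.2]⟩,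
    h.injOn.mono fun t ht => ht.1, ?_⟩
  rintro u ⟨hu, hn⟩
  obtain ⟨t, ht, rfl⟩ := h.surjOn hu
  exact ⟨t, ⟨ht, by have := hs t ht; omega⟩, rfl⟩

theorem ncard_eq_of_bijOn {A : Set T} {B : Set T'} {φ : T → T'} (h : Set.BijOn φ A B) :
    A.ncard = B.ncard := by
  rw [← h.image_eq, h.injOn.ncard_image]

theorem sizeGenFun_eq_of_bijOn {A : Set T} {B : Set T'} {φ : T → T'} (h : Set.BijOn φ A B)
    (hs : ∀ t ∈ A, s' (φ t) = s t) : sizeGenFun s' B = sizeGenFun s A := by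
  ext n
  have := ncard_eq_of_bijOn (bijOn_fiber (k := 0) h hs n)
  simpa [sizeGenFun] using this.symm

theorem sizeGenFun_eq_X_mul_of_bijOn {A : Set T} {B : Set T'} {φ : T → T'}
    (h : Set.BijOn φ A B) (hs : ∀ t ∈ A, s' (φ t) = s t + 1) :
    sizeGenFun s' B = PowerSeries.X * sizeGenFun s A := by
  ext n
  cases n with
  | zero =>
    have : {t | t ∈ B ∧ s' t = 0} = ∅ := by
      ext u
      simp only [Set.mem_ofPred_eq, Set.mem_empty_iff_false, iff_false]
      rintro ⟨hu, hn⟩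
      obtain ⟨t, ht, rfl⟩ := h.surjOn hu
      have := hs t ht
      omega
    simp [sizeGenFun, this]
  | succ n =>
    rw [PowerSeries.coeff_succ_X_mul]
    have := ncard_eq_of_bijOn (bijOn_fiber h hs n)
    simp [sizeGenFun, ← this]

/-- Finiteness matters because `Set.ncard` is 0 on infinite sets, so counts would not add. -/
theorem sizeGenFun_union {A B : Set T} (hA : FiniteFibers s A) (hB : FiniteFibers s B)
    (hd : Disjoint A B) : sizeGenFun s (A ∪ B) = sizeGenFun s A + sizeGenFun s B := by
  ext n
  have : {t | t ∈ A ∪ B ∧ s t = n} = {t | t ∈ A ∧ s t = n} ∪ {t | t ∈ B ∧ s t = n} := by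
    ext t
    simp only [Set.mem_union, Set.mem_ofPred_eq]
    tauto
  simp only [sizeGenFun, PowerSeries.coeff_mk, map_add]
  rw [this, Set.ncard_union_eq _ (hA n) (hB n)]
  · push_cast; rfl
  · exact hd.mono (fun t ht => ht.1) (fun t ht => ht.1)

theorem sizeGenFun_singleton {t : T} (ht : s t = 0) : sizeGenFun s {t} = 1 := by
  ext n
  simp only [sizeGenFun, PowerSeries.coeff_mk, PowerSeries.coeff_one]
  split_ifs with h
  · have : {u | u ∈ ({t} : Set T) ∧ s u = n} = {t} := by
      ext u
      simp only [Set.mem_singleton_iff, Set.mem_ofPred_eq, and_iff_left_iff_imp]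
      rintro rfl
      omega
    rw [this]
    simp
  · have : {u | u ∈ ({t} : Set T) ∧ s u = n} = ∅ := by
      ext u
      simp only [Set.mem_singleton_iff, Set.mem_ofPred_eq, Set.mem_empty_iff_false, iff_false]
      rintro ⟨rfl, h'⟩
      omega
    rw [this]
    simp

theorem sizeGenFun_insert {A : Set T} (hA : FiniteFibers s A) {t : T} (ht : s t = 0)
    (htA : t ∉ A) : sizeGenFun s (insert t A) = 1 + sizeGenFun s A := by
  rw [Set.insert_eq, sizeGenFun_union _ hA (by simpa using htA), sizeGenFun_singleton ht]
  exact fun n => (Set.finite_singleton t).subset fun u hu => hu.1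

theorem sizeGenFun_prod {A : Set T} {B : Set T'} (hA : FiniteFibers s A)
    (hB : FiniteFibers s' B) :
    sizeGenFun (fun p : T × T' => s p.1 + s' p.2) (A ×ˢ B) =
      sizeGenFun s A * sizeGenFun s' B := by
  ext n
  rw [PowerSeries.coeff_mul]
  simp only [sizeGenFun, PowerSeries.coeff_mk]
  have : {p : T × T' | p ∈ A ×ˢ B ∧ s p.1 + s' p.2 = n} =
      ⋃ q ∈ ((Finset.HasAntidiagonal.antidiagonal n : Finset (ℕ × ℕ)) : Set (ℕ × ℕ)),
        ({t | t ∈ A ∧ s t = q.1} ×ˢ {t | t ∈ B ∧ s' t = q.2}) := by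
    ext p
    simp only [Set.mem_ofPred_eq, Set.mem_prod, Set.mem_iUnion, Finset.mem_coe,
      Finset.HasAntidiagonal.mem_antidiagonal]
    constructor
    · rintro ⟨⟨h1, h2⟩, h3⟩
      exact ⟨(s p.1, s' p.2), h3, ⟨h1, rfl⟩, h2, rfl⟩
    · rintro ⟨q, hq, ⟨h1, h2⟩, h3, h4⟩
      exact ⟨⟨h1, h3⟩, by omega⟩
  rw [this, (Finset.finite_toSet _).ncard_biUnion (fun q _ => (hA _).prod (hB _)),
    finsum_mem_coe_finset]
  · simp [Set.ncard_prod]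
  · rintro q - r - hqr
    refine Set.disjoint_left.2 fun p hp hp' => hqr (Prod.ext ?_ ?_)
    · exact hp.1.2.symm.trans hp'.1.2
    · exact hp.2.2.symm.trans hp'.2.2

end GenFun

/-! ### Permutation lists and merges. -/

/-- The list `l` is the one-line notation of a permutation of `0, 1, …, l.length - 1`. -/
def IsPermList (l : List ℕ) : Prop := l.Nodup ∧ ∀ a, a ∈ l ↔ a < l.length

/-- Two lists which together list `0, 1, …` once each, such that no descent of one list straddles
an entry of the other. -/
structure IsMerge (p : List ℕ × List ℕ) : Prop where
  isPermList : IsPermList (p.1 ++ p.2)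
  fst_descent : ∀ c a, [c, a].Sublist p.1 → ∀ b ∈ p.2, a < b → b < c → False
  snd_descent : ∀ c a, [c, a].Sublist p.2 → ∀ b ∈ p.1, a < b → b < c → False

/-- Every entry of the second list is below some entry of the first list. -/
def TopFst (p : List ℕ × List ℕ) : Prop := ∀ b ∈ p.2, ∃ a ∈ p.1, b < a

/-- The total length of a pair of lists. -/
def pairLength (p : List ℕ × List ℕ) : ℕ := p.1.length + p.2.length

/-- Put the list `B` on top of the second list of the pair. -/
def glue (q : (List ℕ × List ℕ) × List ℕ) : List ℕ × List ℕ :=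
  (q.1.1, q.1.2 ++ q.2.map (· + pairLength q.1))

theorem isPermList_iff_of_nodup {l : List ℕ} (h : l.Nodup) :
    IsPermList l ↔ ∀ a ∈ l, a < l.length := by
  refine ⟨fun h' a => (h'.2 a).1, fun h' => ⟨h, fun a => ⟨h' a, fun ha => ?_⟩⟩⟩
  have hs : l.toFinset ⊆ Finset.range l.length := fun a ha => by
    simpa using h' a (by simpa using ha)
  have := Finset.eq_of_subset_of_card_le hs (by simp [List.toFinset_card_of_nodup h])
  have h2 : a ∈ l.toFinset := by rw [this]; simpa using ha
  simpa using h2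

theorem isPermList_of_lt_iff {l : List ℕ} (h : l.Nodup) {m : ℕ} (hm : ∀ a, a ∈ l ↔ a < m) :
    IsPermList l ∧ l.length = m := by
  have hs : l.toFinset = Finset.range m := by ext a; simp [hm]
  have : l.length = m := by
    rw [← List.toFinset_card_of_nodup h, hs, Finset.card_range]
  exact ⟨⟨h, by rwa [this]⟩, this⟩

theorem IsPermList.nil : IsPermList [] := by simp [IsPermList]

theorem IsPermList.append_comm {l l' : List ℕ} : IsPermList (l ++ l') ↔ IsPermList (l' ++ l) := by
  simp only [IsPermList, List.length_append, List.mem_append, List.nodup_append_comm (l₁ := l),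
    Nat.add_comm l.length, or_comm]

theorem IsMerge.swap {p : List ℕ × List ℕ} (h : IsMerge p) : IsMerge p.swap :=
  ⟨IsPermList.append_comm.1 h.isPermList, h.snd_descent, h.fst_descent⟩

theorem finiteFibers_isPermList : FiniteFibers List.length {l | IsPermList l} := by
  intro n
  refine ((List.finite_length_eq (Fin n) n).image
    fun l : List (Fin n) => l.map Fin.val).subset ?_
  rintro l ⟨⟨-, hl⟩, rfl⟩
  refine ⟨l.pmap (fun a ha => ⟨a, ha⟩) fun a ha => (hl a).1 ha, by simp, ?_⟩
  change List.map _ _ = l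
  rw [List.map_pmap]
  simp

theorem finiteFibers_isMerge : FiniteFibers pairLength {p | IsMerge p} := by
  intro n
  refine Set.Finite.of_injOn (f := fun p => (p.1 ++ p.2, p.1.length))
    (t := {l | l ∈ {l | IsPermList l} ∧ l.length = n} ×ˢ Set.Iic n) ?_ ?_
    ((finiteFibers_isPermList n).prod (Set.finite_Iic n))
  · rintro p ⟨hp, rfl⟩
    exact ⟨⟨hp.isPermList, by simp [pairLength]⟩, by simp [pairLength]⟩
  · rintro ⟨a, b⟩ - ⟨a', b'⟩ - h
    simp only [Prod.mk.injEq] at h ⊢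
    exact List.append_inj h.1 h.2

theorem pairLength_glue (q : (List ℕ × List ℕ) × List ℕ) :
    pairLength (glue q) = pairLength q.1 + q.2.length := by
  simp [pairLength, glue, Nat.add_assoc]

theorem IsMerge.fst_lt {p : List ℕ × List ℕ} (h : IsMerge p) {a : ℕ} (ha : a ∈ p.1) :
    a < pairLength p := by
  have := (h.isPermList.2 a).1 (by simp [ha])
  simpa [pairLength] using this

theorem IsMerge.snd_lt {p : List ℕ × List ℕ} (h : IsMerge p) {a : ℕ} (ha : a ∈ p.2) :
    a < pairLength p := by
  have := (h.isPermList.2 a).1 (by simp [ha])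
  simpa [pairLength] using this

theorem IsMerge.mem_fst_or {p : List ℕ × List ℕ} (h : IsMerge p) {a : ℕ}
    (ha : a < pairLength p) : a ∈ p.1 ∨ a ∈ p.2 := by
  have := (h.isPermList.2 a).2 (by simpa [pairLength] using ha)
  simpa using this

theorem TopFst.pred_mem {p : List ℕ × List ℕ} (h : IsMerge p) (ht : TopFst p)
    (hp : 0 < pairLength p) : pairLength p - 1 ∈ p.1 := by
  rcases h.mem_fst_or (a := pairLength p - 1) (by omega) with h1 | h1
  · exact h1
  · obtain ⟨a, ha, hlt⟩ := ht _ h1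
    have := h.fst_lt ha
    omega

/-! ### Short sublists of concatenations and of mapped lists. -/

theorem List.pair_sublist_append {α : Type*} {a b : α} {l l' : List α} :
    [a, b].Sublist (l ++ l') ↔
      [a, b].Sublist l ∨ a ∈ l ∧ b ∈ l' ∨ [a, b].Sublist l' := by
  rw [List.sublist_append_iff]
  simp only [List.cons_eq_append_iff, List.nil_eq_append_iff]
  constructor
  · rintro ⟨l1, l2, ⟨rfl, rfl⟩ | ⟨l1, rfl, ⟨rfl, rfl⟩ | ⟨l1, rfl, rfl, rfl⟩⟩, h1, h2⟩ <;> simp_all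
  · rintro (h | ⟨h, h'⟩ | h)
    · exact ⟨[a, b], [], by simp, h, by simp⟩
    · exact ⟨[a], [b], by simp, by simpa, by simpa⟩
    · exact ⟨[], [a, b], by simp, by simp, h⟩

theorem List.triple_sublist_append {α : Type*} {a b c : α} {l l' : List α} :
    [a, b, c].Sublist (l ++ l') ↔
      [a, b, c].Sublist l ∨ [a, b].Sublist l ∧ c ∈ l' ∨ a ∈ l ∧ [b, c].Sublist l' ∨
        [a, b, c].Sublist l' := by
  rw [List.sublist_append_iff]
  simp only [List.cons_eq_append_iff, List.nil_eq_append_iff]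
  constructor
  · rintro ⟨l1, l2, ⟨rfl, rfl⟩ | ⟨l1, rfl, ⟨rfl, rfl⟩ | ⟨l1, rfl, ⟨rfl, rfl⟩ |
      ⟨l1, rfl, rfl, rfl⟩⟩⟩, h1, h2⟩ <;> simp_all
  · rintro (h | ⟨h, h'⟩ | ⟨h, h'⟩ | h)
    · exact ⟨[a, b, c], [], by simp, h, by simp⟩
    · exact ⟨[a, b], [c], by simp, by simpa, by simpa⟩
    · exact ⟨[a], [b, c], by simp, by simpa, by simpa⟩
    · exact ⟨[], [a, b, c], by simp, by simp, h⟩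

theorem List.quadruple_sublist_append {α : Type*} {a b c d : α} {l l' : List α} :
    [a, b, c, d].Sublist (l ++ l') ↔
      [a, b, c, d].Sublist l ∨ [a, b, c].Sublist l ∧ d ∈ l' ∨
        [a, b].Sublist l ∧ [c, d].Sublist l' ∨ a ∈ l ∧ [b, c, d].Sublist l' ∨
        [a, b, c, d].Sublist l' := by
  rw [List.sublist_append_iff]
  simp only [List.cons_eq_append_iff, List.nil_eq_append_iff]
  constructor
  · rintro ⟨l1, l2, ⟨rfl, rfl⟩ | ⟨l1, rfl, ⟨rfl, rfl⟩ | ⟨l1, rfl, ⟨rfl, rfl⟩ |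
      ⟨l1, rfl, ⟨rfl, rfl⟩ | ⟨l1, rfl, rfl, rfl⟩⟩⟩⟩, h1, h2⟩ <;> simp_all
  · rintro (h | ⟨h, h'⟩ | ⟨h, h'⟩ | ⟨h, h'⟩ | h)
    · exact ⟨[a, b, c, d], [], by simp, h, by simp⟩
    · exact ⟨[a, b, c], [d], by simp, by simpa, by simpa⟩
    · exact ⟨[a, b], [c, d], by simp, by simpa, by simpa⟩
    · exact ⟨[a], [b, c, d], by simp, by simpa, by simpa⟩
    · exact ⟨[], [a, b, c, d], by simp, by simp, h⟩

theorem exists_pair_sublist_map {f : ℕ → ℕ} {l : List ℕ} {a b : ℕ} :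
    [a, b].Sublist (l.map f) ↔ ∃ a' b', [a', b'].Sublist l ∧ a = f a' ∧ b = f b' := by
  rw [List.sublist_map_iff]
  constructor
  · rintro ⟨l', h, he⟩
    match l', he with
    | [x, y], he => simp at he; exact ⟨x, y, h, he.1, he.2⟩
  · rintro ⟨x, y, h, rfl, rfl⟩
    exact ⟨_, h, rfl⟩

/-! ### Cutting a block off the top of a merge. -/

/-- With no inversion across the level `m`, no small entry can follow a large one. -/
theorem eq_filter_append_filter {m : ℕ} {l : List ℕ}
    (h : ∀ c a, [c, a].Sublist l → a < m → m ≤ c → False) :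
    l = l.filter (· < m) ++ l.filter (m ≤ ·) := by
  induction l with
  | nil => simp
  | cons x l ih =>
    have ih := ih fun c a hs => h c a (hs.cons _)
    by_cases hx : x < m
    · simp only [List.filter_cons, hx, decide_true, if_true, List.cons_append, Nat.not_le.2 hx,
        decide_false]
      simpa using ih
    · have hall : ∀ a ∈ l, m ≤ a := fun a ha => by
        by_contra ham
        exact h x a (by simpa using ha) (by omega) (by omega)
      have h1 : (x :: l).filter (· < m) = [] := by
        simp only [List.filter_eq_nil_iff, List.mem_cons, decide_eq_true_eq]
        rintro a (rfl | ha)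
        · exact hx
        · have := hall a ha; omega
      have h2 : (x :: l).filter (m ≤ ·) = x :: l := by
        simp only [List.filter_eq_self, List.mem_cons, decide_eq_true_eq]
        rintro a (rfl | ha)
        · omega
        · exact hall a ha
      rw [h1, h2, List.nil_append]

theorem isMerge_glue {p : List ℕ × List ℕ} {B : List ℕ} (hp : IsMerge p) (hB : IsPermList B) :
    IsMerge (glue (p, B)) := by
  have hB' := hB.2
  refine ⟨?_, ?_, ?_⟩
  · have hnd : ((p.1 ++ p.2) ++ B.map (· + pairLength p)).Nodup := by
      rw [List.nodup_append]
      refine ⟨hp.isPermList.1, hB.1.map (add_left_injective _), fun a ha b hb => ?_⟩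
      have := (hp.isPermList.2 a).1 ha
      simp only [List.mem_map] at hb
      obtain ⟨c, -, rfl⟩ := hb
      simp only [List.length_append, pairLength] at *
      omega
    have := (isPermList_iff_of_nodup hnd).2 fun a ha => by
      simp only [List.mem_append, List.mem_map] at ha
      simp only [List.length_append, List.length_map]
      rcases ha with (ha | ha) | ⟨b, hb, rfl⟩
      · have := hp.fst_lt ha; simp only [pairLength] at this; omega
      · have := hp.snd_lt ha; simp only [pairLength] at this; omega
      · have := (hB' b).1 hb; simp only [pairLength]; omega
    simpa [glue] using this
  · intro c a hs b hb hab hbc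
    simp only [glue, List.mem_append, List.mem_map] at hs hb
    rcases hb with hb | ⟨b, -, rfl⟩
    · exact hp.fst_descent c a hs b hb hab hbc
    · have := hp.fst_lt (hs.subset (by simp : c ∈ [c, a]))
      omega
  · intro c a hs b hb hab hbc
    simp only [glue, List.pair_sublist_append] at hs hb
    have hb' := hp.fst_lt hb
    rcases hs with hs | ⟨hc, ha⟩ | hs
    · exact hp.snd_descent c a hs b hb hab hbc
    · have := hp.snd_lt hc
      simp only [List.mem_map] at ha
      obtain ⟨b, -, rfl⟩ := ha
      omega
    · have := hs.subset (by simp : a ∈ [c, a])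
      simp only [List.mem_map] at this
      obtain ⟨b, -, rfl⟩ := this
      omega

theorem exists_isMerge_glue {p : List ℕ × List ℕ} (hp : IsMerge p) :
    ∃ q B, IsMerge q ∧ TopFst q ∧ IsPermList B ∧ glue (q, B) = p := by
  obtain ⟨α, β⟩ := p
  -- The cutting level is one more than the maximum of `α`, or 0 if `α` is empty.
  obtain ⟨m, hm, hm'⟩ : ∃ m, (∀ a ∈ α, a < m) ∧ (0 < m → m - 1 ∈ α) := by
    rcases α.eq_nil_or_concat with rfl | ⟨l, a, rfl⟩
    · exact ⟨0, by simp, by simp⟩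
    · obtain ⟨M, hM, hmax⟩ := (l ++ [a]).toFinset.exists_max_image id ⟨a, by simp⟩
      refine ⟨M + 1, fun b hb => ?_, fun _ => ?_⟩
      · have := hmax b (by simpa [or_comm] using hb)
        simp only [id] at this
        omega
      · simpa [or_comm] using hM
  have hsplit : β = β.filter (· < m) ++ β.filter (m ≤ ·) := by
    -- An inversion of `β` across the level `m` would straddle the entry `m - 1` of `α`.
    refine eq_filter_append_filter fun c a hs ha hc => ?_
    have hmem := hm' (by omega)
    have hne : a ≠ m - 1 := by
      rintro rfl
      exact (List.nodup_append.1 hp.isPermList.1).2.2 _ hmem _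
        (hs.subset (by simp : m - 1 ∈ [c, m - 1])) rfl
    exact hp.snd_descent c a hs (m - 1) hmem (by omega) (by omega)
  have hnd := hp.isPermList.1
  have hmem := hp.isPermList.2
  simp only at hnd hmem
  have hmle : m ≤ (α ++ β).length := by
    by_contra h
    have := (hmem (m - 1)).1 (by simp [hm' (by omega)])
    omega
  obtain ⟨hq, hqm⟩ := isPermList_of_lt_iff (l := α ++ β.filter (· < m)) (m := m)
    (hnd.sublist (List.filter_sublist.append_left α)) fun a => by
      have h1 := hmem a
      have h2 := hm a
      simp only [List.mem_append, List.mem_filter, decide_eq_true_eq] at h1 ⊢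
      constructor
      · rintro (h | h)
        · exact h2 h
        · exact h.2
      · intro h
        have := h1.2 (by omega)
        tauto
  have hqm' : pairLength (α, β.filter (· < m)) = m := by
    simpa [pairLength] using hqm
  have hback : ((β.filter (m ≤ ·)).map (· - m)).map (· + m) = β.filter (m ≤ ·) := by
    rw [List.map_map]
    conv_rhs => rw [← List.map_id (β.filter (m ≤ ·))]
    refine List.map_congr_left fun a ha => ?_
    have : m ≤ a := by simpa using (List.mem_filter.1 ha).2
    simp [this]
  refine ⟨(α, β.filter (· < m)), (β.filter (m ≤ ·)).map (· - m), ⟨hq, ?_, ?_⟩, ?_, ?_, ?_⟩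
  · intro c a hs b hb
    exact hp.fst_descent c a hs b (List.mem_filter.1 hb).1
  · intro c a hs b hb
    exact hp.snd_descent c a (hs.trans List.filter_sublist) b hb
  · intro b hb
    have hlt : b < m := by simpa using (List.mem_filter.1 hb).2
    have h := hm' (by omega)
    refine ⟨m - 1, h, ?_⟩
    have : b ≠ m - 1 := by
      rintro rfl
      exact (List.nodup_append.1 hnd).2.2 _ h _ (List.mem_filter.1 hb).1 rfl
    omega
  · refine (isPermList_of_lt_iff (m := (α ++ β).length - m) ?_ fun a => ?_).1
    · refine List.Nodup.of_map (· + m) ?_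
      rw [hback]
      exact (List.nodup_append.1 hnd).2.1.filter _
    · have h1 : a ∈ (β.filter (m ≤ ·)).map (· - m) ↔ a + m ∈ β := by
        simp only [List.mem_map, List.mem_filter, decide_eq_true_eq]
        constructor
        · rintro ⟨b, ⟨hb, hmb⟩, rfl⟩
          rwa [Nat.sub_add_cancel hmb]
        · intro h
          exact ⟨a + m, ⟨h, by omega⟩, by omega⟩
      rw [h1]
      have h2 := hmem (a + m)
      simp only [List.mem_append] at h2
      have h3 := hm (a + m)
      constructor
      · intro h
        have := h2.1 (Or.inr h)
        omega
      · intro h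
        rcases h2.2 (by omega) with h | h
        · have := h3 h; omega
        · exact h
  · simp only [glue, hqm', Prod.mk.injEq, true_and]
    rw [hback, ← hsplit]

/-- The length of a nonempty top-first merge is one more than the maximum of its first list. Gluing
leaves that list unchanged, so the place of the cut can be recovered. -/
theorem glue_injOn : Set.InjOn glue {q | IsMerge q.1 ∧ TopFst q.1} := by
  rintro ⟨⟨α, β⟩, B⟩ ⟨h1, h2⟩ ⟨⟨α', β'⟩, B'⟩ ⟨h1', h2'⟩ h
  simp only [glue, Prod.mk.injEq] at h h1 h2 h1' h2'
  obtain ⟨rfl, h⟩ := h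
  have key : ∀ β β' : List ℕ, IsMerge (α, β) → IsMerge (α, β') → TopFst (α, β) →
      pairLength (α, β) ≤ pairLength (α, β') := by
    intro β β' h h' ht
    by_contra hlt
    have h3 := ht.pred_mem h (by omega)
    have h4 : pairLength (α, β) - 1 < pairLength (α, β') := h'.fst_lt h3
    omega
  have hlen : pairLength (α, β) = pairLength (α, β') :=
    le_antisymm (key _ _ h1 h1' h2) (key _ _ h1' h1 h2')
  rw [hlen] at h
  have hl : β.length = β'.length := by simpa [pairLength] using hlen
  obtain ⟨rfl, hBB⟩ := List.append_inj h hl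
  rw [List.map_injective_iff.2 (add_left_injective _) hBB]

/-- Gluing restricts to a bijection between a product of two classes and a class which is
described compatibly. -/
theorem sizeGenFun_glue {A : Set (List ℕ × List ℕ)} {C : Set (List ℕ)}
    {Z : Set (List ℕ × List ℕ)} (hA : ∀ p ∈ A, IsMerge p ∧ TopFst p)
    (hC : ∀ B ∈ C, IsPermList B) (hZ : ∀ p ∈ Z, IsMerge p)
    (h : ∀ p B, IsMerge p → TopFst p → IsPermList B → (glue (p, B) ∈ Z ↔ p ∈ A ∧ B ∈ C)) :
    sizeGenFun pairLength Z = sizeGenFun pairLength A * sizeGenFun List.length C := by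
  rw [← sizeGenFun_prod (finiteFibers_isMerge.mono fun p hp => (hA p hp).1)
    (finiteFibers_isPermList.mono hC)]
  refine sizeGenFun_eq_of_bijOn (φ := glue) ⟨?_, ?_, ?_⟩ fun q _ => pairLength_glue q
  · rintro ⟨p, B⟩ ⟨hp, hB⟩
    exact (h p B (hA p hp).1 (hA p hp).2 (hC B hB)).2 ⟨hp, hB⟩
  · exact glue_injOn.mono fun q hq => hA q.1 hq.1
  · intro p hp
    obtain ⟨q, B, hq, ht, hB, rfl⟩ := exists_isMerge_glue (hZ p hp)
    exact ⟨(q, B), (h q B hq ht hB).1 hp, rfl⟩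

/-! ### Pattern avoidance and blocks placed on top. -/

/-- The list `l` contains no subsequence order isomorphic to `213`. -/
def Avoids213 (l : List ℕ) : Prop :=
  ∀ a b c, [a, b, c].Sublist l → b < a → a < c → False

/-- The list `l` contains no subsequence order isomorphic to `4213` or `3142`. -/
def AvoidsBoth (l : List ℕ) : Prop :=
  (∀ a b c d, [a, b, c, d].Sublist l → c < b → b < d → d < a → False) ∧
    ∀ a b c d, [a, b, c, d].Sublist l → b < d → d < a → a < c → False

/-- The nonempty permutation lists with property `P`. -/
def nonemptyPermLists (P : List ℕ → Prop) : Set (List ℕ) := {l | IsPermList l ∧ l ≠ [] ∧ P l}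

/-- The merges of a list with property `P` and a list with property `Q` which are empty or have
their greatest entry in the first list. -/
def mergesTopFst (P Q : List ℕ → Prop) : Set (List ℕ × List ℕ) :=
  {p | IsMerge p ∧ TopFst p ∧ P p.1 ∧ Q p.2}

theorem exists_triple_sublist_map {f : ℕ → ℕ} {l : List ℕ} {a b c : ℕ} :
    [a, b, c].Sublist (l.map f) ↔
      ∃ a' b' c', [a', b', c'].Sublist l ∧ a = f a' ∧ b = f b' ∧ c = f c' := by
  rw [List.sublist_map_iff]
  constructor
  · rintro ⟨l', h, he⟩
    match l', he with
    | [x, y, z], he => simp at he; exact ⟨x, y, z, h, he⟩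
  · rintro ⟨x, y, z, h, rfl, rfl, rfl⟩
    exact ⟨_, h, rfl⟩

theorem exists_quadruple_sublist_map {f : ℕ → ℕ} {l : List ℕ} {a b c d : ℕ} :
    [a, b, c, d].Sublist (l.map f) ↔
      ∃ a' b' c' d', [a', b', c', d'].Sublist l ∧ a = f a' ∧ b = f b' ∧ c = f c' ∧ d = f d' := by
  rw [List.sublist_map_iff]
  constructor
  · rintro ⟨l', h, he⟩
    match l', he with
    | [x, y, z, w], he => simp at he; exact ⟨x, y, z, w, h, he⟩
  · rintro ⟨x, y, z, w, h, rfl, rfl, rfl, rfl⟩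
    exact ⟨_, h, rfl⟩

theorem AvoidsBoth.sublist {l l' : List ℕ} (h : AvoidsBoth l) (hs : l'.Sublist l) :
    AvoidsBoth l' :=
  ⟨fun a b c d h' => h.1 a b c d (h'.trans hs), fun a b c d h' => h.2 a b c d (h'.trans hs)⟩

theorem Avoids213.sublist {l l' : List ℕ} (h : Avoids213 l) (hs : l'.Sublist l) :
    Avoids213 l' := fun a b c h' => h a b c (h'.trans hs)

theorem avoids213_map_add {l : List ℕ} {m : ℕ} : Avoids213 (l.map (· + m)) ↔ Avoids213 l := by
  constructor
  · intro h a b c hs h1 h2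
    exact h (a + m) (b + m) (c + m) (hs.map (· + m)) (by omega) (by omega)
  · intro h a b c hs h1 h2
    obtain ⟨a, b, c, hs', rfl, rfl, rfl⟩ := exists_triple_sublist_map.1 hs
    exact h a b c hs' (by omega) (by omega)

theorem avoidsBoth_map_add {l : List ℕ} {m : ℕ} :
    AvoidsBoth (l.map (· + m)) ↔ AvoidsBoth l := by
  constructor
  · intro h
    refine ⟨fun a b c d hs h1 h2 h3 => ?_, fun a b c d hs h1 h2 h3 => ?_⟩
    · exact h.1 (a + m) (b + m) (c + m) (d + m) (hs.map (· + m)) (by omega) (by omega) (by omega)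
    · exact h.2 (a + m) (b + m) (c + m) (d + m) (hs.map (· + m)) (by omega) (by omega) (by omega)
  · intro h
    refine ⟨fun a b c d hs h1 h2 h3 => ?_, fun a b c d hs h1 h2 h3 => ?_⟩ <;>
    obtain ⟨a, b, c, d, hs', rfl, rfl, rfl, rfl⟩ := exists_quadruple_sublist_map.1 hs
    · exact h.1 a b c d hs' (by omega) (by omega) (by omega)
    · exact h.2 a b c d hs' (by omega) (by omega) (by omega)

theorem mem_map_add {B : List ℕ} {m b : ℕ} (h : b ∈ B.map (· + m)) : m ≤ b := by
  obtain ⟨c, -, rfl⟩ := List.mem_map.1 h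
  omega

/-- Both 4213 and 3142 are sum indecomposable, so an occurrence cannot use entries of both the lower
list and the block above it. -/
theorem avoidsBoth_append_map_add {l B : List ℕ} {m : ℕ} (hl : ∀ a ∈ l, a < m) :
    AvoidsBoth (l ++ B.map (· + m)) ↔ AvoidsBoth l ∧ AvoidsBoth B := by
  constructor
  · intro h
    exact ⟨h.sublist (List.sublist_append_left _ _),
      avoidsBoth_map_add.1 (h.sublist (List.sublist_append_right _ _))⟩
  · rintro ⟨h, h'⟩
    have h' := avoidsBoth_map_add (m := m) |>.2 h'
    have hB := @mem_map_add B m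
    generalize B.map (· + m) = B at h' hB
    refine ⟨fun a b c d hs h1 h2 h3 => ?_, fun a b c d hs h1 h2 h3 => ?_⟩ <;>
    rw [List.quadruple_sublist_append] at hs <;>
    rcases hs with hs | ⟨hs, hs'⟩ | ⟨hs, hs'⟩ | ⟨hs, hs'⟩ | hs
    · exact h.1 a b c d hs h1 h2 h3
    · have := hl a (hs.subset (by simp)); have := hB hs'; omega
    · have := hl a (hs.subset (by simp)); have := @hB d (hs'.subset (by simp)); omega
    · have := hl a hs; have := @hB d (hs'.subset (by simp)); omega
    · exact h'.1 a b c d hs h1 h2 h3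
    · exact h.2 a b c d hs h1 h2 h3
    · have := hl a (hs.subset (by simp)); have := hB hs'; omega
    · have := hl a (hs.subset (by simp)); have := @hB d (hs'.subset (by simp)); omega
    · have := hl a hs; have := @hB d (hs'.subset (by simp)); omega
    · exact h'.2 a b c d hs h1 h2 h3

theorem pairwise_lt_append_map_add {l B : List ℕ} {m : ℕ} (hl : ∀ a ∈ l, a < m) :
    (l ++ B.map (· + m)).Pairwise (· < ·) ↔ l.Pairwise (· < ·) ∧ B.Pairwise (· < ·) := by
  rw [List.pairwise_append, List.pairwise_map]
  simp only [Nat.add_lt_add_iff_right]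
  refine ⟨fun h => ⟨h.1, h.2.1⟩, fun h => ⟨h.1, h.2, fun a ha b hb => ?_⟩⟩
  have := hl a ha
  have := mem_map_add hb
  omega

/-- An inversion of `l` followed by any entry of the block above is a 213, which is why the block
has to be nonempty. -/
theorem avoids213_append_map_add {l B : List ℕ} {m : ℕ} (hnd : l.Nodup) (hl : ∀ a ∈ l, a < m)
    (hB : B ≠ []) :
    Avoids213 (l ++ B.map (· + m)) ↔ l.Pairwise (· < ·) ∧ Avoids213 B := by
  constructor
  · intro h
    refine ⟨?_, avoids213_map_add.1 (h.sublist (List.sublist_append_right _ _))⟩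
    rw [List.pairwise_iff_forall_sublist]
    intro a b hs
    by_contra hab
    have hne : a ≠ b := by simpa using hnd.sublist hs
    obtain ⟨c, hc⟩ := List.exists_mem_of_ne_nil B hB
    have := hl a (hs.subset (by simp))
    refine h a b (c + m) ?_ (by omega) (by omega)
    exact List.triple_sublist_append.2 (Or.inr (Or.inl ⟨hs, List.mem_map.2 ⟨c, hc, rfl⟩⟩))
  · rintro ⟨h, h'⟩ a b c hs h1 h2
    have h' := avoids213_map_add (m := m) |>.2 h'
    rw [List.pairwise_iff_forall_sublist] at h
    have hB := @mem_map_add B m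
    rw [List.triple_sublist_append] at hs
    rcases hs with hs | ⟨hs, hs'⟩ | ⟨hs, hs'⟩ | hs
    · have := h ((by simp : [a, b].Sublist [a, b, c]).trans hs); omega
    · have := h hs; omega
    · have := hl a hs; have := @hB b (hs'.subset (by simp)); omega
    · exact h' a b c hs h1 h2

/-- After a swap of the two lists, a nonempty merge has its greatest entry in the second list, so a
nonempty block comes off there and leaves a top-first merge. The summand 1 counts the empty pair.
Each use exchanges the roles of the two lists. -/
theorem sizeGenFun_mergesTopFst {P Q Q₁ Q₂ : List ℕ → Prop} (hP : P []) (hQ : Q [])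
    (h : ∀ m l B, l.Nodup → (∀ a ∈ l, a < m) → B ≠ [] →
      (Q (l ++ B.map (· + m)) ↔ Q₁ l ∧ Q₂ B)) :
    sizeGenFun pairLength (mergesTopFst Q P) =
      1 + sizeGenFun pairLength (mergesTopFst P Q₁) *
        sizeGenFun List.length (nonemptyPermLists Q₂) := by
  have hswap : sizeGenFun pairLength (mergesTopFst Q P) =
      sizeGenFun pairLength {p | IsMerge p ∧ TopFst p.swap ∧ P p.1 ∧ Q p.2} := by
    refine sizeGenFun_eq_of_bijOn (φ := Prod.swap) ⟨?_, Prod.swap_injective.injOn, ?_⟩ ?_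
    · rintro p ⟨h1, h2, h3, h4⟩
      exact ⟨h1.swap, h2, h4, h3⟩
    · rintro p ⟨h1, h2, h3, h4⟩
      exact ⟨p.swap, ⟨h1.swap, h2, h4, h3⟩, rfl⟩
    · intro p _
      simp [pairLength, Nat.add_comm]
  have hins : {p | IsMerge p ∧ TopFst p.swap ∧ P p.1 ∧ Q p.2} =
      insert (([], []) : List ℕ × List ℕ)
        {p | IsMerge p ∧ TopFst p.swap ∧ P p.1 ∧ Q p.2 ∧ p.2 ≠ []} := by
    ext ⟨a, b⟩
    simp only [Set.mem_ofPred_eq, Set.mem_insert_iff, Prod.mk.injEq]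
    constructor
    · rintro ⟨h1, h2, h3, h4⟩
      by_cases hb : b = []
      · refine Or.inl ⟨List.eq_nil_iff_forall_not_mem.2 fun x hx => ?_, hb⟩
        obtain ⟨y, hy, -⟩ := h2 x hx
        simp [hb] at hy
      · exact Or.inr ⟨h1, h2, h3, h4, hb⟩
    · rintro (⟨rfl, rfl⟩ | ⟨h1, h2, h3, h4, h5⟩)
      · exact ⟨⟨by simpa using IsPermList.nil, by simp, by simp⟩, by simp [TopFst], hP, hQ⟩
      · exact ⟨h1, h2, h3, h4⟩
  rw [hswap, hins, sizeGenFun_insert _ (by simp [pairLength]) (by simp), sizeGenFun_glue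
    (A := mergesTopFst P Q₁) (C := nonemptyPermLists Q₂)]
  · exact fun p hp => ⟨hp.1, hp.2.1⟩
  · exact fun B hB => hB.1
  · exact fun p hp => hp.1
  · rintro ⟨a, b⟩ B hp ht hB
    -- With an empty block the greatest entry would have to lie in both lists.
    by_cases hBnil : B = []
    · subst hBnil
      simp only [glue, List.map_nil, List.append_nil, nonemptyPermLists, Set.mem_ofPred_eq,
        ne_eq, not_true_eq_false, false_and, and_false, iff_false]
      rintro ⟨-, h2, -, -, h5⟩
      obtain ⟨x, hx⟩ := List.exists_mem_of_ne_nil _ h5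
      have h6 := ht.pred_mem hp (by have := hp.snd_lt hx; omega)
      obtain ⟨y, hy, hlt⟩ := h2 _ h6
      have := hp.snd_lt hy
      omega
    · have hsplit := h (pairLength (a, b)) b B (List.nodup_append.1 hp.isPermList.1).2.1
        (fun x hx => hp.snd_lt hx) hBnil
      have hm := isMerge_glue hp hB
      have htop : TopFst (glue ((a, b), B)).swap := by
        intro x hx
        obtain ⟨c, hc⟩ := List.exists_mem_of_ne_nil B hBnil
        refine ⟨c + pairLength (a, b), ?_, ?_⟩
        · simp only [glue, Prod.fst_swap, List.mem_append, List.mem_map]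
          exact Or.inr ⟨c, hc, rfl⟩
        · have := hp.fst_lt (a := x) hx
          omega
      simp only [Set.mem_ofPred_eq, mergesTopFst, nonemptyPermLists, hm, htop, hp, ht, hB,
        hBnil, true_and, ne_eq, not_false_eq_true]
      simp only [glue, hsplit]
      simp [hBnil, and_assoc]
  · exact finiteFibers_isMerge.mono fun p hp => hp.1

/-! ### Splitting a permutation at its least entry. -/

/-- Raise all entries of both lists by one and put the new least entry `0` between them. -/
def surroundZero (p : List ℕ × List ℕ) : List ℕ := p.1.map (· + 1) ++ 0 :: p.2.map (· + 1)

theorem length_surroundZero (p : List ℕ × List ℕ) :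
    (surroundZero p).length = pairLength p + 1 := by
  simp [surroundZero, pairLength, Nat.add_assoc]

theorem surroundZero_injective : Function.Injective surroundZero := by
  rintro ⟨a, b⟩ ⟨a', b'⟩ h
  have hidx : ∀ a b : List ℕ, (surroundZero (a, b)).idxOf 0 = a.length := fun a b => by
    rw [surroundZero, List.idxOf_append_of_notMem (by simp)]
    simp
  have hlen : a.length = a'.length := by rw [← hidx a b, h, hidx]
  obtain ⟨h1, h2⟩ := List.append_inj h (by simpa using hlen)
  have hinj := List.map_injective_iff.2 (add_left_injective 1)
  exact Prod.ext (hinj h1) (hinj (List.cons.inj h2).2)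

theorem isPermList_surroundZero {p : List ℕ × List ℕ} :
    IsPermList (surroundZero p) ↔ IsPermList (p.1 ++ p.2) := by
  have hperm : (surroundZero p).Perm (0 :: (p.1 ++ p.2).map (· + 1)) := by
    rw [List.map_append]
    exact List.perm_middle
  simp only [IsPermList, hperm.nodup_iff, hperm.mem_iff, hperm.length_eq, List.nodup_cons,
    List.nodup_map_iff (add_left_injective 1), List.mem_cons, List.length_cons, List.length_map]
  refine and_congr (by simp) ⟨fun h a => ?_, fun h a => ?_⟩
  · simpa using h (a + 1)
  · cases a with
    | zero => simp
    | succ a => simpa using h a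

theorem exists_surroundZero {l : List ℕ} (h : IsPermList l) (hl : l ≠ []) :
    ∃ p, surroundZero p = l := by
  have h0 : 0 ∈ l := (h.2 0).2 (List.length_pos_iff.2 hl)
  obtain ⟨s, t, rfl⟩ := List.append_of_mem h0
  have hnd := h.1
  have hs : 0 ∉ s ∧ 0 ∉ t := by
    rw [List.nodup_middle, List.nodup_cons] at hnd
    simpa using hnd.1
  have key : ∀ s : List ℕ, 0 ∉ s → (s.map (· - 1)).map (· + 1) = s := by
    intro s hs
    rw [List.map_map]
    conv_rhs => rw [← List.map_id s]
    refine List.map_congr_left fun a ha => ?_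
    have : a ≠ 0 := by rintro rfl; exact hs ha
    simp
    omega
  exact ⟨(s.map (· - 1), t.map (· - 1)), by simp only [surroundZero, key s hs.1, key t hs.2]⟩

theorem sizeGenFun_nonemptyPermLists {P : List ℕ → Prop} {Z : Set (List ℕ × List ℕ)}
    (h : ∀ p, IsPermList (p.1 ++ p.2) → (P (surroundZero p) ↔ p ∈ Z))
    (hZ : ∀ p ∈ Z, IsPermList (p.1 ++ p.2)) :
    sizeGenFun List.length (nonemptyPermLists P) =
      PowerSeries.X * sizeGenFun pairLength Z := by
  refine sizeGenFun_eq_X_mul_of_bijOn (φ := surroundZero)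
    ⟨fun p hp => ?_, surroundZero_injective.injOn, ?_⟩ fun p _ => length_surroundZero p
  · refine ⟨isPermList_surroundZero.2 (hZ p hp), ?_, (h p (hZ p hp)).2 hp⟩
    simp [surroundZero]
  · rintro l ⟨h1, h2, h3⟩
    obtain ⟨p, rfl⟩ := exists_surroundZero h1 h2
    exact ⟨p, (h p (isPermList_surroundZero.1 h1)).1 h3, rfl⟩

theorem sizeGenFun_permLists {P : List ℕ → Prop} (hP : P []) :
    sizeGenFun List.length {l | IsPermList l ∧ P l} =
      1 + sizeGenFun List.length (nonemptyPermLists P) := by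
  have : {l | IsPermList l ∧ P l} = insert [] (nonemptyPermLists P) := by
    ext l
    simp only [nonemptyPermLists, Set.mem_ofPred_eq, Set.mem_insert_iff]
    constructor
    · rintro ⟨h1, h2⟩
      by_cases hl : l = []
      · exact Or.inl hl
      · exact Or.inr ⟨h1, hl, h2⟩
    · rintro (rfl | ⟨h1, -, h2⟩)
      · exact ⟨IsPermList.nil, hP⟩
      · exact ⟨h1, h2⟩
  rw [this, sizeGenFun_insert _ (by simp) (by simp [nonemptyPermLists])]
  exact finiteFibers_isPermList.mono fun l hl => hl.1

theorem Avoids213.avoidsBoth {l : List ℕ} (h : Avoids213 l) : AvoidsBoth l :=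
  ⟨fun a b c d hs h1 h2 _ => h b c d ((by simp : [b, c, d].Sublist [a, b, c, d]).trans hs) h1 h2,
    fun a b c d hs h1 h2 h3 =>
      h a b c ((by simp : [a, b, c].Sublist [a, b, c, d]).trans hs) (by omega) h3⟩

theorem avoids213_nil : Avoids213 [] := fun a b c h => by simp at h

theorem avoidsBoth_nil : AvoidsBoth [] := avoids213_nil.avoidsBoth

/-! ### The equation for the class itself. -/

/-- The merges whose second list avoids `213` below the greatest entry of the first list, and both
of whose lists avoid `4213` and `3142`. -/
def goodMerges : Set (List ℕ × List ℕ) :=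
  {p | IsMerge p ∧ AvoidsBoth p.1 ∧ AvoidsBoth p.2 ∧
    ∀ a b c, [a, b, c].Sublist p.2 → b < a → a < c → ∀ x ∈ p.1, c < x → False}

theorem avoidsBoth_surroundZero {p : List ℕ × List ℕ} (hp : IsPermList (p.1 ++ p.2)) :
    AvoidsBoth (surroundZero p) ↔ p ∈ goodMerges := by
  obtain ⟨α, β⟩ := p
  constructor
  · intro h
    have hα : (α.map (· + 1)).Sublist (surroundZero (α, β)) := List.sublist_append_left _ _
    have hβ : (β.map (· + 1)).Sublist (surroundZero (α, β)) :=
      (List.sublist_cons_self _ _).trans (List.sublist_append_right _ _)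
    refine ⟨⟨hp, ?_, ?_⟩, avoidsBoth_map_add.1 (h.sublist hα), avoidsBoth_map_add.1 (h.sublist hβ),
      ?_⟩
    · intro c a hs b hb hab hbc
      -- The new 0 is the 1 of a 4213.
      refine h.1 (c + 1) (a + 1) 0 (b + 1) ?_ (by omega) (by omega) (by omega)
      exact List.Sublist.append (l₁ := [c + 1, a + 1]) (hs.map (· + 1))
        ((List.singleton_sublist.2 (List.mem_map.2 ⟨b, hb, rfl⟩)).cons_cons 0)
    -- Here 0 is the 1 of a 3142.
    · intro c a hs b hb hab hbc
      refine h.2 (b + 1) 0 (c + 1) (a + 1) ?_ (by omega) (by omega) (by omega)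
      exact List.Sublist.append (l₁ := [b + 1])
        (List.singleton_sublist.2 (List.mem_map.2 ⟨b, hb, rfl⟩)) ((hs.map (· + 1)).cons_cons 0)
    · intro a b c hs hba hac x hx hcx
      refine h.1 (x + 1) (a + 1) (b + 1) (c + 1) ?_ (by omega) (by omega) (by omega)
      exact List.Sublist.append (l₁ := [x + 1])
        (List.singleton_sublist.2 (List.mem_map.2 ⟨x, hx, rfl⟩)) ((hs.map (· + 1)).cons 0)
  · rintro ⟨⟨-, h1, h2⟩, hα, hβ, h3⟩
    have h1 : ∀ c a, [c, a].Sublist (α.map (· + 1)) → ∀ b ∈ 0 :: β.map (· + 1),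
        a < b → b < c → False := by
      intro c a hs b hb hab hbc
      obtain ⟨c, a, hs', rfl, rfl⟩ := exists_pair_sublist_map.1 hs
      rcases List.mem_cons.1 hb with rfl | hb
      · omega
      · obtain ⟨b, hb', rfl⟩ := List.mem_map.1 hb
        exact h1 c a hs' b hb' (by omega) (by omega)
    have h2 : ∀ c a, [c, a].Sublist (β.map (· + 1)) → ∀ b ∈ α.map (· + 1),
        a < b → b < c → False := by
      intro c a hs b hb hab hbc
      obtain ⟨c, a, hs', rfl, rfl⟩ := exists_pair_sublist_map.1 hs
      obtain ⟨b, hb', rfl⟩ := List.mem_map.1 hb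
      exact h2 c a hs' b hb' (by omega) (by omega)
    have h3 : ∀ a b c, [a, b, c].Sublist (β.map (· + 1)) → b < a → a < c →
        ∀ x ∈ α.map (· + 1), c < x → False := by
      intro a b c hs hba hac x hx hcx
      obtain ⟨a, b, c, hs', rfl, rfl, rfl⟩ := exists_triple_sublist_map.1 hs
      obtain ⟨x, hx', rfl⟩ := List.mem_map.1 hx
      exact h3 a b c hs' (by omega) (by omega) x hx' (by omega)
    replace hα := avoidsBoth_map_add (m := 1) |>.2 hα
    replace hβ := avoidsBoth_map_add (m := 1) |>.2 hβ
    have hpair : ∀ {c d : ℕ} {l : List ℕ}, [c, d].Sublist l → d ∈ l := fun h => h.subset (by simp)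
    -- Each occurrence is sorted by how many of its entries precede 0.
    refine ⟨fun a b c d hs hcb hbd hda => ?_, fun a b c d hs hbd hda hac => ?_⟩ <;>
    rw [surroundZero, List.quadruple_sublist_append] at hs <;>
    rcases hs with hs | ⟨hs, hs'⟩ | ⟨hs, hs'⟩ | ⟨hs, hs'⟩ | hs
    · exact hα.1 a b c d hs hcb hbd hda
    · exact h1 a b ((by simp : [a, b].Sublist [a, b, c]).trans hs) d hs' hbd hda
    · exact h1 a b hs d (hpair hs') hbd hda
    · rcases List.sublist_cons_iff.1 hs' with hs' | ⟨r, hr, hs'⟩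
      · exact h3 b c d hs' hcb hbd a hs hda
      · simp only [List.cons.injEq] at hr
        omega
    · rcases List.sublist_cons_iff.1 hs with hs' | ⟨r, hr, hs'⟩
      · exact hβ.1 a b c d hs' hcb hbd hda
      · simp only [List.cons.injEq] at hr
        omega
    · exact hα.2 a b c d hs hbd hda hac
    · exact h1 a b ((by simp : [a, b].Sublist [a, b, c]).trans hs) d hs' hbd hda
    · exact h1 a b hs d (hpair hs') hbd hda
    -- Whether or not `b` is the entry 0, the inversion `c`, `d` lies in `β` and straddles `a`.
    · have : [c, d].Sublist (β.map (· + 1)) := by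
        rcases List.sublist_cons_iff.1 hs' with hs' | ⟨r, hr, hs'⟩
        · exact (by simp : [c, d].Sublist [b, c, d]).trans hs'
        · simp only [List.cons.injEq] at hr
          rwa [hr.2]
      exact h2 c d this a hs hda hac
    · rcases List.sublist_cons_iff.1 hs with hs' | ⟨r, hr, hs'⟩
      · exact hβ.2 a b c d hs' hbd hda hac
      · simp only [List.cons.injEq] at hr
        omega

theorem glue_mem_goodMerges {p : List ℕ × List ℕ} {B : List ℕ} (hp : IsMerge p) (ht : TopFst p)
    (hB : IsPermList B) :
    glue (p, B) ∈ goodMerges ↔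
      p ∈ mergesTopFst AvoidsBoth Avoids213 ∧ B ∈ {l | IsPermList l ∧ AvoidsBoth l} := by
  have happ := avoidsBoth_append_map_add (B := B) fun a (ha : a ∈ p.2) => hp.snd_lt ha
  constructor
  · rintro ⟨-, h1, h2, h3⟩
    simp only [glue] at h1 h2 h3
    refine ⟨⟨hp, ht, h1, fun a b c hs hba hac => ?_⟩, hB, (happ.1 h2).2⟩
    obtain ⟨x, hx, hcx⟩ := ht c (hs.subset (by simp))
    exact h3 a b c (hs.trans (List.sublist_append_left _ _)) hba hac x hx hcx
  · rintro ⟨⟨-, -, h1, h2⟩, -, h3⟩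
    refine ⟨isMerge_glue hp hB, h1, happ.2 ⟨h2.avoidsBoth, h3⟩, ?_⟩
    intro a b c hs hba hac x hx hcx
    -- An occurrence of 213 ending below an entry of the first list cannot end in the top block.
    have hc : ∀ y ∈ B.map (· + pairLength p), y ≠ c := by
      rintro y hy rfl
      have := mem_map_add hy
      have := hp.fst_lt hx
      omega
    simp only [glue, List.triple_sublist_append] at hs
    rcases hs with hs | ⟨-, hs⟩ | ⟨-, hs⟩ | hs
    · exact h2 a b c hs hba hac
    · exact hc c hs rfl
    · exact hc c (hs.subset (by simp)) rfl
    · exact hc c (hs.subset (by simp)) rfl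

theorem sizeGenFun_avoidsBoth :
    sizeGenFun List.length (nonemptyPermLists AvoidsBoth) =
      PowerSeries.X * (sizeGenFun pairLength (mergesTopFst AvoidsBoth Avoids213) *
        (1 + sizeGenFun List.length (nonemptyPermLists AvoidsBoth))) := by
  rw [← sizeGenFun_permLists avoidsBoth_nil,
    sizeGenFun_nonemptyPermLists (Z := goodMerges) (fun p hp => avoidsBoth_surroundZero hp)
      fun p hp => hp.1.isPermList,
    sizeGenFun_glue (Z := goodMerges) (A := mergesTopFst AvoidsBoth Avoids213)
      (C := {l | IsPermList l ∧ AvoidsBoth l}) (fun p hp => ⟨hp.1, hp.2.1⟩)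
      (fun B hB => hB.1) (fun p hp => hp.1) fun p B hp ht hB => glue_mem_goodMerges hp ht hB]

/-! ### The series of 213-avoiders and of increasing permutations. -/

theorem avoids213_surroundZero {p : List ℕ × List ℕ} :
    Avoids213 (surroundZero p) ↔
      Avoids213 p.1 ∧ Avoids213 p.2 ∧ ∀ a ∈ p.1, ∀ b ∈ p.2, b ≤ a := by
  obtain ⟨α, β⟩ := p
  constructor
  · intro h
    have hα : (α.map (· + 1)).Sublist (surroundZero (α, β)) := List.sublist_append_left _ _
    have hβ : (β.map (· + 1)).Sublist (surroundZero (α, β)) :=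
      (List.sublist_cons_self _ _).trans (List.sublist_append_right _ _)
    refine ⟨avoids213_map_add.1 (h.sublist hα), avoids213_map_add.1 (h.sublist hβ), ?_⟩
    intro a ha b hb
    by_contra hab
    refine h (a + 1) 0 (b + 1) ?_ (by omega) (by omega)
    exact List.Sublist.append (l₁ := [a + 1])
      (List.singleton_sublist.2 (List.mem_map.2 ⟨a, ha, rfl⟩))
      ((List.singleton_sublist.2 (List.mem_map.2 ⟨b, hb, rfl⟩)).cons_cons 0)
  · rintro ⟨hα, hβ, h⟩
    replace hα := avoids213_map_add (m := 1) |>.2 hα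
    replace hβ := avoids213_map_add (m := 1) |>.2 hβ
    replace h : ∀ a ∈ α.map (· + 1), ∀ b ∈ 0 :: β.map (· + 1), b ≤ a := by
      intro a ha b hb
      obtain ⟨a, ha', rfl⟩ := List.mem_map.1 ha
      rcases List.mem_cons.1 hb with rfl | hb
      · omega
      · obtain ⟨b, hb', rfl⟩ := List.mem_map.1 hb
        have := h a ha' b hb'
        omega
    intro a b c hs hba hac
    rw [surroundZero, List.triple_sublist_append] at hs
    rcases hs with hs | ⟨hs, hs'⟩ | ⟨hs, hs'⟩ | hs
    · exact hα a b c hs hba hac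
    · have := h a (hs.subset (by simp)) c hs'
      omega
    · have := h a hs c (hs'.subset (by simp))
      omega
    · rcases List.sublist_cons_iff.1 hs with hs' | ⟨r, hr, hs'⟩
      · exact hβ a b c hs' hba hac
      · simp only [List.cons.injEq] at hr
        omega

/-- No entry before 0 is below an entry after it, so the two sides are independent 213-avoiders, one
on top of the other. Gluing applies once the lower one is stored as a pair with empty second list.
-/
theorem sizeGenFun_avoids213 :
    sizeGenFun List.length (nonemptyPermLists Avoids213) =
      PowerSeries.X * (1 + sizeGenFun List.length (nonemptyPermLists Avoids213)) ^ 2 := by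
  have hfst : sizeGenFun pairLength
      {p | IsPermList p.1 ∧ Avoids213 p.1 ∧ p.2 = []} =
      sizeGenFun List.length {l | IsPermList l ∧ Avoids213 l} := by
    refine sizeGenFun_eq_of_bijOn (φ := fun l => (l, [])) ⟨?_, ?_, ?_⟩ ?_
    · exact fun l hl => ⟨hl.1, hl.2, rfl⟩
    · exact fun l _ l' _ h => (Prod.mk.inj h).1
    · rintro ⟨a, b⟩ ⟨h1, h2, rfl⟩
      exact ⟨a, ⟨h1, h2⟩, rfl⟩
    · simp [pairLength]
  have hswap : sizeGenFun pairLength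
      {p | IsPermList (p.1 ++ p.2) ∧ Avoids213 p.1 ∧ Avoids213 p.2 ∧
        ∀ a ∈ p.1, ∀ b ∈ p.2, b ≤ a} =
      sizeGenFun pairLength {p | IsPermList (p.1 ++ p.2) ∧ Avoids213 p.1 ∧ Avoids213 p.2 ∧
        ∀ a ∈ p.2, ∀ b ∈ p.1, b ≤ a} := by
    refine sizeGenFun_eq_of_bijOn (φ := Prod.swap) ⟨?_, Prod.swap_injective.injOn, ?_⟩ ?_
    · rintro p ⟨h1, h2, h3, h4⟩
      exact ⟨IsPermList.append_comm.1 h1, h3, h2, h4⟩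
    · rintro p ⟨h1, h2, h3, h4⟩
      exact ⟨p.swap, ⟨IsPermList.append_comm.1 h1, h3, h2, h4⟩, rfl⟩
    · intro p _
      simp [pairLength, Nat.add_comm]
  have hmerge : ∀ p : List ℕ × List ℕ, IsPermList (p.1 ++ p.2) →
      (∀ a ∈ p.2, ∀ b ∈ p.1, b ≤ a) → IsMerge p := by
    refine fun p h1 h2 => ⟨h1, fun c a hs b hb hab hbc => ?_, fun c a hs b hb hab hbc => ?_⟩
    · have := h2 b hb c (hs.subset (by simp))
      omega
    · have := h2 a (hs.subset (by simp)) b hb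
      omega
  have hglue := sizeGenFun_glue
    (A := {p | IsPermList p.1 ∧ Avoids213 p.1 ∧ p.2 = []})
    (C := {l | IsPermList l ∧ Avoids213 l})
    (Z := {p | IsPermList (p.1 ++ p.2) ∧ Avoids213 p.1 ∧ Avoids213 p.2 ∧
        ∀ a ∈ p.2, ∀ b ∈ p.1, b ≤ a}) ?_ (fun B hB => hB.1) (fun p hp => hmerge p hp.1 hp.2.2.2) ?_
  · rw [← sizeGenFun_permLists avoids213_nil, sizeGenFun_nonemptyPermLists (P := Avoids213)
      (Z := {p | IsPermList (p.1 ++ p.2) ∧ Avoids213 p.1 ∧ Avoids213 p.2 ∧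
        ∀ a ∈ p.1, ∀ b ∈ p.2, b ≤ a}) (fun p hp => by
          rw [avoids213_surroundZero]
          exact ⟨fun h => ⟨hp, h⟩, fun h => h.2⟩) fun p hp => hp.1, hswap, hglue, hfst, sq]
  · rintro ⟨a, b⟩ ⟨h1, -, rfl⟩
    refine ⟨hmerge _ (by simpa using h1) (by simp), by simp [TopFst]⟩
  · rintro ⟨a, b⟩ B hp ht hB
    constructor
    · rintro ⟨h1, h2, h3, h4⟩
      simp only [glue] at h1 h2 h3 h4
      have hb : b = [] := List.eq_nil_iff_forall_not_mem.2 fun y hy => by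
        obtain ⟨x, hx, hlt⟩ := ht y hy
        have := h4 y (by simp [hy]) x hx
        omega
      subst hb
      exact ⟨⟨by simpa using hp.isPermList, h2, rfl⟩, hB, avoids213_map_add.1 (by simpa using h3)⟩
    · rintro ⟨⟨h1, h2, h3⟩, -, h4⟩
      simp only at h1 h2 h3
      subst h3
      refine ⟨(isMerge_glue hp hB).isPermList, h2, ?_, ?_⟩
      · simpa [glue] using avoids213_map_add.2 h4
      · intro y hy x hx
        simp only [glue, List.nil_append] at hx hy
        have := mem_map_add hy
        have := hp.fst_lt hx
        omega

theorem sizeGenFun_increasing :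
    (1 + sizeGenFun List.length (nonemptyPermLists (List.Pairwise (· < ·)))) *
      (1 - PowerSeries.X) = 1 := by
  rw [← sizeGenFun_permLists List.Pairwise.nil]
  refine Eq.trans ?_ (PowerSeries.mk_one_mul_one_sub_eq_one ℤ)
  congr 1
  ext n
  simp only [sizeGenFun, PowerSeries.coeff_mk, Pi.one_apply, Nat.cast_eq_one]
  refine Set.ncard_eq_one.2 ⟨List.range n, ?_⟩
  ext l
  simp only [Set.mem_ofPred_eq, Set.mem_singleton_iff]
  constructor
  · rintro ⟨⟨h1, h2⟩, rfl⟩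
    have hperm : l.Perm (List.range l.length) :=
      (List.perm_ext_iff_of_nodup h1.1 List.nodup_range).2 fun a => by rw [h1.2, List.mem_range]
    exact hperm.eq_of_pairwise (fun a b _ _ hab hba => absurd hab (by omega)) h2
      List.pairwise_lt_range
  · rintro rfl
    exact ⟨⟨⟨List.nodup_range, by simp⟩, List.pairwise_lt_range⟩, by simp⟩

/-! ### From permutations of `Fin n` to lists. -/

theorem quadruple_sublist_ofFn {n : ℕ} {w : Fin n → ℕ} {a b c d : ℕ} :
    [a, b, c, d].Sublist (List.ofFn w) ↔
      ∃ g : Fin 4 → Fin n, StrictMono g ∧ a = w (g 0) ∧ b = w (g 1) ∧ c = w (g 2) ∧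
        d = w (g 3) := by
  rw [List.sublist_iff_exists_fin_orderEmbedding_get_eq]
  constructor
  · rintro ⟨f, hf⟩
    refine ⟨fun i => Fin.cast List.length_ofFn (f i), fun i j hij => f.strictMono hij, ?_⟩
    have h0 := hf (0 : Fin 4)
    have h1 := hf (1 : Fin 4)
    have h2 := hf (2 : Fin 4)
    have h3 := hf (3 : Fin 4)
    rw [List.get_ofFn] at h0 h1 h2 h3
    exact ⟨h0, h1, h2, h3⟩
  · rintro ⟨g, hg, rfl, rfl, rfl, rfl⟩
    refine ⟨OrderEmbedding.ofStrictMono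
      (fun i : Fin 4 => Fin.cast List.length_ofFn.symm (g i)) fun i j hij => hg hij, ?_⟩
    intro i
    rw [List.get_ofFn]
    change Fin 4 at i
    fin_cases i <;> rfl

theorem permContains_perm4213_iff {n : ℕ} {π : Equiv.Perm (Fin n)} :
    PermContains perm4213 π ↔ ∃ a b c d, [a, b, c, d].Sublist (List.ofFn fun i => (π i : ℕ)) ∧
      c < b ∧ b < d ∧ d < a := by
  constructor
  · rintro ⟨g, hg, h⟩
    exact ⟨_, _, _, _, quadruple_sublist_ofFn.2 ⟨g, hg, rfl, rfl, rfl, rfl⟩,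
      (h 2 1).1 (by decide), (h 1 3).1 (by decide), (h 3 0).1 (by decide)⟩
  · rintro ⟨a, b, c, d, hs, h1, h2, h3⟩
    obtain ⟨g, hg, rfl, rfl, rfl, rfl⟩ := quadruple_sublist_ofFn.1 hs
    refine ⟨g, hg, fun i j => ?_⟩
    simp only [Fin.lt_def (n := n)]
    fin_cases i <;> fin_cases j <;> simp [perm4213] <;> omega

theorem permContains_perm3142_iff {n : ℕ} {π : Equiv.Perm (Fin n)} :
    PermContains perm3142 π ↔ ∃ a b c d, [a, b, c, d].Sublist (List.ofFn fun i => (π i : ℕ)) ∧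
      b < d ∧ d < a ∧ a < c := by
  constructor
  · rintro ⟨g, hg, h⟩
    exact ⟨_, _, _, _, quadruple_sublist_ofFn.2 ⟨g, hg, rfl, rfl, rfl, rfl⟩,
      (h 1 3).1 (by decide), (h 3 0).1 (by decide), (h 0 2).1 (by decide)⟩
  · rintro ⟨a, b, c, d, hs, h1, h2, h3⟩
    obtain ⟨g, hg, rfl, rfl, rfl, rfl⟩ := quadruple_sublist_ofFn.1 hs
    refine ⟨g, hg, fun i j => ?_⟩
    simp only [Fin.lt_def (n := n)]
    fin_cases i <;> fin_cases j <;> simp [perm3142] <;> omega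

theorem mem_avPair_iff {n : ℕ} {π : Equiv.Perm (Fin n)} :
    π ∈ avPair perm4213 perm3142 n ↔ AvoidsBoth (List.ofFn fun i => (π i : ℕ)) := by
  simp only [avPair, Set.mem_ofPred_eq, permContains_perm4213_iff, permContains_perm3142_iff,
    AvoidsBoth, not_exists, not_and]

theorem bijOn_ofFn_avPair (n : ℕ) :
    Set.BijOn (fun π : Equiv.Perm (Fin n) => List.ofFn fun i => (π i : ℕ))
      (avPair perm4213 perm3142 n) {l | (IsPermList l ∧ AvoidsBoth l) ∧ l.length = n} := by
  refine ⟨fun π hπ => ⟨⟨?_, mem_avPair_iff.1 hπ⟩, by simp⟩, fun π _ π' _ h => ?_, ?_⟩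
  · refine (isPermList_iff_of_nodup ?_).2 fun a ha => ?_
    · exact List.nodup_ofFn.2 (Fin.val_injective.comp π.injective)
    · obtain ⟨i, rfl⟩ := (List.mem_ofFn' _ _).1 ha
      simp
  · ext i
    exact congrFun (List.ofFn_injective h) i
  · rintro l ⟨⟨h1, h2⟩, rfl⟩
    let w : Fin l.length → Fin l.length := fun i => ⟨l.get i, (h1.2 _).1 (l.get_mem i)⟩
    have hw : Function.Injective w := fun i j h =>
      List.nodup_iff_injective_get.1 h1.1 (Fin.mk.inj h)
    have hl : (List.ofFn fun i => (Equiv.ofBijective w (Finite.injective_iff_bijective.1 hw) i : ℕ))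
        = l := by
      simp [w]
    exact ⟨_, mem_avPair_iff.2 (by rwa [hl]), hl⟩

theorem avPairGenFun_eq_sizeGenFun :
    avPairGenFun perm4213 perm3142 =
      sizeGenFun List.length (nonemptyPermLists AvoidsBoth) := by
  ext n
  simp only [avPairGenFun, sizeGenFun, PowerSeries.coeff_mk]
  split_ifs with h
  · have : {l | l ∈ nonemptyPermLists AvoidsBoth ∧ l.length = n} = ∅ := by
      ext l
      simp only [nonemptyPermLists, Set.mem_ofPred_eq, Set.mem_empty_iff_false, iff_false]
      rintro ⟨⟨-, h1, -⟩, h2⟩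
      exact h1 (List.length_eq_zero_iff.1 (h2.trans h))
    rw [this]
    simp
  · have : {l | l ∈ nonemptyPermLists AvoidsBoth ∧ l.length = n} =
        {l | (IsPermList l ∧ AvoidsBoth l) ∧ l.length = n} := by
      ext l
      simp only [nonemptyPermLists, Set.mem_ofPred_eq]
      refine ⟨fun h1 => ⟨⟨h1.1.1, h1.1.2.2⟩, h1.2⟩, fun h1 => ⟨⟨h1.1.1, ?_, h1.1.2⟩, h1.2⟩⟩
      rintro rfl
      exact h h1.2.symm
    rw [this, ncard_eq_of_bijOn (bijOn_ofFn_avPair n)]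

/-! ### Elimination. -/

theorem polynomial_eq_zero_of_system {R : Type*} [CommRing R] [IsDomain R]
    {x f d y q r z t : R} (hx : x ≠ 0) (hf : f = x * (q * (1 + f))) (hq : q = 1 + r * f)
    (hr : r = 1 + z * d) (hz : z = 1 + t * f) (ht : t = 1 + z * y) (hy : (1 + y) * (1 - x) = 1)
    (hd : d = x * (1 + d) ^ 2) :
    x ^ 3 * f ^ 6
      + (7 * x ^ 3 - 7 * x ^ 2 + 2 * x) * f ^ 5
      + (x ^ 4 + 14 * x ^ 3 - 21 * x ^ 2 + 10 * x - 1) * f ^ 4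
      + (4 * x ^ 4 + 8 * x ^ 3 - 19 * x ^ 2 + 11 * x - 2) * f ^ 3
      + (6 * x ^ 4 - 5 * x ^ 3 - 2 * x ^ 2 + 2 * x) * f ^ 2
      + (4 * x ^ 4 - 7 * x ^ 3 + 4 * x ^ 2 - x) * f
      + (x ^ 4 - 2 * x ^ 3 + x ^ 2) = 0 := by
  -- Eliminating `t` gives z (1 - y f) = 1 + f, and y (1 - x) = x.
  have hz' : z * (1 - x - x * f) = (1 + f) * (1 - x) := by
    subst ht
    linear_combination (1 - x) * hz + z * f * hy
  have hf' : f = x * (1 + f) * (1 + f + f * d * z) := by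
    subst hr
    subst hq
    linear_combination hf
  -- This has the form U = V d with U and V polynomials in x and f.
  have hA : (f - x * (1 + f) ^ 2) * (1 - x - x * f) = x * (1 + f) ^ 2 * (1 - x) * f * d := by
    linear_combination (1 - x - x * f) * hf' + x * (1 + f) * f * d * hz'
  -- Multiplying d = x (1 + d)^2 by V^2 and using V d = U gives x U^2 + (2x - 1) U V + x V^2 = 0.
  -- Its left side is x times the required polynomial.
  refine (mul_eq_zero.1 ?_).resolve_left hx
  linear_combination
    (x * ((f - x * (1 + f) ^ 2) * (1 - x - x * f) + x * (1 + f) ^ 2 * (1 - x) * f * d) +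
      (2 * x - 1) * (x * (1 + f) ^ 2 * (1 - x) * f)) * hA -
    (x * (1 + f) ^ 2 * (1 - x) * f) ^ 2 * hd

theorem theorem2p1 (x f : PowerSeries ℤ) (hx : x = PowerSeries.X)
    (hf : f = avPairGenFun perm4213 perm3142) :
    x ^ 3 * f ^ 6
      + (7 * x ^ 3 - 7 * x ^ 2 + 2 * x) * f ^ 5
      + (x ^ 4 + 14 * x ^ 3 - 21 * x ^ 2 + 10 * x - 1) * f ^ 4
      + (4 * x ^ 4 + 8 * x ^ 3 - 19 * x ^ 2 + 11 * x - 2) * f ^ 3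
      + (6 * x ^ 4 - 5 * x ^ 3 - 2 * x ^ 2 + 2 * x) * f ^ 2
      + (4 * x ^ 4 - 7 * x ^ 3 + 4 * x ^ 2 - x) * f
      + (x ^ 4 - 2 * x ^ 3 + x ^ 2) = 0 := by
  subst hx hf
  rw [avPairGenFun_eq_sizeGenFun]
  exact polynomial_eq_zero_of_system PowerSeries.X_ne_zero sizeGenFun_avoidsBoth
    (sizeGenFun_mergesTopFst avoids213_nil avoidsBoth_nil
      fun m l B _ hl _ => avoidsBoth_append_map_add hl)
    (sizeGenFun_mergesTopFst avoidsBoth_nil avoids213_nil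
      fun m l B hnd hl hB => avoids213_append_map_add hnd hl hB)
    (sizeGenFun_mergesTopFst List.Pairwise.nil avoidsBoth_nil
      fun m l B _ hl _ => avoidsBoth_append_map_add hl)
    (sizeGenFun_mergesTopFst avoidsBoth_nil List.Pairwise.nil
      fun m l B _ hl _ => pairwise_lt_append_map_add hl)
    sizeGenFun_increasing sizeGenFun_avoids213
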